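/- Let $D$ be an integral domain of Krull dimension $1$ with field of fractions $K$, and let $\Theta:=\{D_M\mid M\in\mathrm{Max}(D)\}$ be the family of its localizations at maximal ideals, regarded as subrings of $K$. Then the Jaffard degree of $\Theta$ equals the Cantor–Bendixson rank of $\mathrm{Max}(D)^{\mathrm{inv}}$. The terms are as follows. For a domain $A$ with field of fractions $K$, a set $\Lambda$ of rings $T$ with $A\subseteq T\subseteq K$ is a *Jaffard family of $A$* if: (1) $K\notin\Lambda$ or $\Lambda=\{K\}$; (2) every $T\in\Lambda$ is flat over $A$; (3) $I=\bigcap_{T\in\Lambda}IT$ for every ideal $I$ of $A$; (4) for all $S\neq T$ in $\Lambda$, the only prime ideal of $A$ that is both the contraction of a prime ideal of $S$ and the contraction of a prime ideal of $T$ is $(0)$; (5) every nonzero $x\in K$ is a nonunit of only finitely many $T\in\Lambda$ (that is, $x\in T$ and $x$ is not a unit of $T$). A ring $T$ is a *Jaffard overring of $A$* if it belongs to some Jaffard family of $A$. Define for every ordinal $\alpha$ a family $\Theta_\alpha\subseteq\Theta$ and a ring $T_\alpha$ by transfinite recursion: $\Theta_0:=\Theta$ and $T_0:=D$; $\Theta_{\alpha+1}:=\Theta_\alpha\setminus\{T\mid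 T\text{ is a Jaffard overring of }T_\alpha\}$; $\Theta_\alpha:=\bigcap_{\beta<\alpha}\Theta_\beta$ if $\alpha$ is a limit ordinal; and, for $\alpha>0$, $T_\alpha:=\bigcap_{S\in\Theta_\alpha}S$, with $T_\alpha:=K$ if $\Theta_\alpha=\emptyset$. The *Jaffard degree* of $\Theta$ is the least ordinal $\alpha$ such that $T_\alpha=T_\beta$ for all $\beta>\alpha$. $\mathrm{Max}(D)^{\mathrm{inv}}$ is the set of maximal ideals of $D$ with the topology induced by the inverse topology on $\mathrm{Spec}(D)$, i.e. the topology generated by the sets $V(I)=\{P\mid I\subseteq P\}$ with $I$ a finitely generated ideal. The *Cantor–Bendixson rank* of a topological space $X$ is the least ordinal $\alpha$ with $\mathcal L^\alpha(X)=\mathcal L^{\alpha+1}(X)$, where $\mathcal L^0(X)=X$, $\mathcal L^{\alpha+1}(X)$ is the set of non-isolated points of the subspace $\mathcal L^\alpha(X)$, and $\mathcal L^\alpha(X)=\bigcap_{\beta<\alpha}\mathcal L^\beta(X)$ for limit ordinals $\alpha$. -/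

import Mathlib

universe u

namespace JaffardDegree

section Families

variable {K : Type u} [Field K]

/-- For an overring `T` of `A`, the set of primes `Q ∩ A`, with `Q` a prime ideal of `T`. -/
def sigma {A T : Subring K} (h : A ≤ T) : Set (PrimeSpectrum A) :=
  Set.range (PrimeSpectrum.comap (Subring.inclusion h))

/-- The extension `I T`, as a `T`-submodule of the field `K`. -/
def extend {A : Subring K} (I : Ideal A) (T : Subring K) : Submodule T K :=
  Submodule.span T ((fun a : A => (a : K)) '' (I : Set A))

/-- `Θ` is a Jaffard family of `A`; here `A` is a subring of `K` and the members of `Θ` are rings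
between `A` and `K`. (The notion is meant for `K` the field of fractions of `A`.) -/
structure IsJaffardFamily (A : Subring K) (Θ : Set (Subring K)) : Prop where
  overring : ∀ T ∈ Θ, A ≤ T
  top_mem : ⊤ ∉ Θ ∨ Θ = {⊤}
  flat : ∀ T (hT : T ∈ Θ), (Subring.inclusion (overring T hT)).Flat
  complete : ∀ I : Ideal A,
    ((fun a : A => (a : K)) '' (I : Set A)) = ⋂ T ∈ Θ, (extend I T : Set K)
  independent : ∀ S (hS : S ∈ Θ) T (hT : T ∈ Θ), S ≠ T →
    sigma (overring S hS) ∩ sigma (overring T hT) = {⊥}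
  locallyFinite : ∀ x : K, x ≠ 0 →
    {T ∈ Θ | ∃ hx : x ∈ T, ¬ IsUnit (⟨x, hx⟩ : T)}.Finite

/-- `T` is a Jaffard overring of `A`. -/
def IsJaffardOverring (A T : Subring K) : Prop :=
  ∃ Θ : Set (Subring K), IsJaffardFamily A Θ ∧ T ∈ Θ

/-- The pair `(T_α, Θ_α)`, starting from the ring `A` and the family `Θ`. The infimum of the empty
family of subrings of `K` is `⊤`, that is, `K` itself. -/
noncomputable def derivedPair (A : Subring K) (Θ : Set (Subring K)) (α : Ordinal.{u}) :
    Subring K × Set (Subring K) :=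
  Ordinal.limitRecOn α (A, Θ)
    (fun _ p => (sInf (p.2 \ {T | IsJaffardOverring p.1 T}), p.2 \ {T | IsJaffardOverring p.1 T}))
    (fun α _ p => (sInf (⋂ (β) (h : β < α), (p β h).2), ⋂ (β) (h : β < α), (p β h).2))

/-- The ring `T_α` of the derived sequence of the family `Θ` of overrings of `A`. -/
noncomputable def derivedRing (A : Subring K) (Θ : Set (Subring K)) (α : Ordinal.{u}) :
    Subring K :=
  (derivedPair A Θ α).1

/-- The subfamily `Θ_α` of the family `Θ` of overrings of `A`. -/
noncomputable def derivedFamily (A : Subring K) (Θ : Set (Subring K)) (α : Ordinal.{u}) :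
    Set (Subring K) :=
  (derivedPair A Θ α).2

/-- The Jaffard degree: the least `α` such that `T_α = T_β` for all `β > α`. -/
noncomputable def jaffardDegree (A : Subring K) (Θ : Set (Subring K)) : Ordinal.{u} :=
  sInf {α | ∀ β > α, derivedRing A Θ α = derivedRing A Θ β}

theorem derivedRing_zero (A : Subring K) (Θ : Set (Subring K)) : derivedRing A Θ 0 = A := by
  simp [derivedRing, derivedPair]

theorem derivedFamily_zero (A : Subring K) (Θ : Set (Subring K)) : derivedFamily A Θ 0 = Θ := by
  simp [derivedFamily, derivedPair]

theorem derivedFamily_add_one (A : Subring K) (Θ : Set (Subring K)) (α : Ordinal.{u}) :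
    derivedFamily A Θ (α + 1) =
      derivedFamily A Θ α \ {T | IsJaffardOverring (derivedRing A Θ α) T} := by
  simp [derivedFamily, derivedRing, derivedPair]

theorem derivedFamily_limit (A : Subring K) (Θ : Set (Subring K)) {α : Ordinal.{u}}
    (hα : Order.IsSuccLimit α) :
    derivedFamily A Θ α = ⋂ β < α, derivedFamily A Θ β := by
  simp only [derivedFamily, derivedPair]
  rw [Ordinal.limitRecOn_limit _ _ _ _ hα]

theorem derivedRing_eq_sInf (A : Subring K) (Θ : Set (Subring K)) {α : Ordinal.{u}}
    (hα : α ≠ 0) : derivedRing A Θ α = sInf (derivedFamily A Θ α) := by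
  induction α using Ordinal.limitRecOn with
  | zero => exact absurd rfl hα
  | add_one α _ => simp [derivedFamily, derivedRing, derivedPair]
  | limit α h _ =>
    simp only [derivedFamily, derivedRing, derivedPair]
    rw [Ordinal.limitRecOn_limit _ _ _ _ h]

theorem derivedFamily_antitone (A : Subring K) (Θ : Set (Subring K)) :
    Antitone (derivedFamily A Θ) := by
  intro α β h
  induction β using Ordinal.limitRecOn with
  | zero => rw [nonpos_iff_eq_zero.mp h]
  | add_one β ih =>
    rcases h.eq_or_lt with rfl | h
    · exact le_rfl
    · rw [derivedFamily_add_one]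
      exact Set.sdiff_subset.trans (ih (Order.lt_add_one_iff.mp h))
  | limit β hβ _ =>
    rcases h.eq_or_lt with rfl | h
    · exact le_rfl
    · rw [derivedFamily_limit A Θ hβ]
      exact Set.biInter_subset_of_mem (t := fun γ => derivedFamily A Θ γ) h

/-- The Jaffard degree is a genuine minimum: the derived sequence always stabilizes. -/
theorem jaffardDegree_isLeast (A : Subring K) (Θ : Set (Subring K)) :
    IsLeast {α | ∀ β > α, derivedRing A Θ α = derivedRing A Θ β} (jaffardDegree A Θ) := by
  have key : ∀ T : Subring K, ∃ γ : Ordinal.{u}, ∀ δ,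
      T ∈ derivedFamily A Θ γ → T ∈ derivedFamily A Θ δ := by
    intro T
    by_cases h : ∃ γ, T ∉ derivedFamily A Θ γ
    · obtain ⟨γ, hγ⟩ := h
      exact ⟨γ, fun _ h => absurd h hγ⟩
    · push Not at h
      exact ⟨0, fun δ _ => h δ⟩
  choose γ hγ using key
  refine ⟨csInf_mem ⟨(⨆ T, γ T) + 1, fun β hβ => ?_⟩, fun α hα => csInf_le' hα⟩
  have hle : ∀ T, γ T ≤ (⨆ T, γ T) + 1 := fun T =>
    (le_ciSup (Ordinal.bddAbove_of_small (s := Set.range γ)) T).trans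
      (Order.lt_add_one_iff.mpr le_rfl).le
  have hpos : (0 : Ordinal.{u}) < (⨆ T, γ T) + 1 := Order.lt_add_one_iff.mpr zero_le
  rw [derivedRing_eq_sInf A Θ hpos.ne', derivedRing_eq_sInf A Θ (hpos.trans hβ).ne']
  congr 1
  exact Set.Subset.antisymm
    (fun T hT => hγ T β (derivedFamily_antitone A Θ (hle T) hT))
    (derivedFamily_antitone A Θ (le_of_lt hβ))

end Families

/-- The Cantor–Bendixson rank of a topological space `X`: the least `α` such that the `α`-th and
the `(α + 1)`-st Cantor–Bendixson derivatives of `X` coincide. -/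
noncomputable def cantorBendixsonRank (X : Type u) [TopologicalSpace X] : Ordinal.{u} :=
  sInf {α | CantorBendixson.iteratedDerivedSet (Set.univ : Set X) α =
    CantorBendixson.iteratedDerivedSet (Set.univ : Set X) (α + 1)}

/-- The Cantor–Bendixson rank is a genuine minimum. -/
theorem cantorBendixsonRank_isLeast (X : Type u) [TopologicalSpace X] :
    IsLeast {α | CantorBendixson.iteratedDerivedSet (Set.univ : Set X) α =
      CantorBendixson.iteratedDerivedSet (Set.univ : Set X) (α + 1)} (cantorBendixsonRank X) := by
  obtain ⟨a, ha⟩ := CantorBendixson.iteratedDerivedSet_mem_fixedPoints (Set.univ : Set X)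
  refine ⟨csInf_mem ⟨a, ?_⟩, fun α hα => csInf_le' hα⟩
  rw [Set.mem_ofPred_eq, CantorBendixson.iteratedDerivedSet_succ]
  exact (Function.mem_fixedPoints_iff.mp ha).symm

section Domain

variable (D : Type u) [CommRing D]

/-- The inverse topology on the spectrum, generated by the sets `V(I)` with `I` a finitely
generated ideal. -/
@[reducible] def inverseTopology : TopologicalSpace (PrimeSpectrum D) :=
  TopologicalSpace.generateFrom
    {U | ∃ I : Ideal D, I.FG ∧ U = PrimeSpectrum.zeroLocus (I : Set D)}

/-- The set of maximal ideals of `D`, to be endowed with the inverse topology. -/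
def MaxInv : Type u := MaximalSpectrum D

instance : TopologicalSpace (MaxInv D) :=
  (inverseTopology D).induced (MaximalSpectrum.toPrimeSpectrum (R := D))

variable (K : Type u) [IsDomain D] [Field K] [Algebra D K] [IsFractionRing D K]

/-- The localization `D_M`, as a subring of the field of fractions `K` of `D`. -/
noncomputable def localizationAt (M : MaximalSpectrum D) : Subring K :=
  (Localization.subalgebra.ofField K M.asIdeal.primeCompl
    M.asIdeal.primeCompl_le_nonZeroDivisors).toSubring

/-- The family of all localizations of `D` at its maximal ideals. -/
def maxLocalizations : Set (Subring K) :=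
  Set.range (localizationAt D K)

end Domain

end JaffardDegree

/-!
Let `X` be a closed subset of `Max(D)^inv` and `M ∈ X`, and put `C = ⋂ D_N` over `N ∈ X`. Then `D_M`
is a Jaffard overring of `C` if and only if `M` is isolated in `X`.

If `M` is isolated, let `B = ⋂ D_N` over `N ∈ X \ {M}`, so that `C = D_M ∩ B`. Since `X \ {M}` is
closed, some finitely generated `I ≤ M` lies in no other member of `X`. For `y ≠ 0` the ring `D/(y)`
is zero-dimensional, so there `V(I)` is clopen and defines an idempotent; a lift `e` of it gives
`e / y ∈ D_M` and `(1 - e) / y ∈ B`. These partitions of unity make `{D_M, B}` a Jaffard family of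
`C`. The same splitting shows that `D_M` contains the intersection over a closed set only if `M`
belongs to that set.

Conversely, in a Jaffard family of `C` containing `D_M`, independence forces `M` to extend to the
unit ideal in every other member. By local finiteness a single finitely generated `J ≤ M` already
does so. An `N ∈ X` containing `J` is proper in some member of the family by completeness, and this
member can only be `D_M`; hence `N = M`.

So removing the Jaffard overrings from `{D_N | N ∈ X}` amounts to passing to the derived set of `X`.
Since a closed `X` can be recovered from `⋂ D_N`, both sequences stabilize at the same stage.
-/

namespace JaffardDegree

section Splitting

variable {K : Type u} [Field K]

theorem exists_common_denominator (C : Subring K) [IsFractionRing C K] (s : Finset K) :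
    ∃ y : K, y ≠ 0 ∧ ∀ x ∈ s, y * x ∈ C := by
  obtain ⟨y, hy⟩ := IsLocalization.exist_integer_multiples_of_finset (nonZeroDivisors C) s
  refine ⟨(y : C), fun h => nonZeroDivisors.coe_ne_zero y (Subtype.ext h), fun x hx => ?_⟩
  obtain ⟨c, hc⟩ := hy x hx
  have hc : (c : K) = (y : C) * x := hc
  exact hc ▸ c.2

theorem exists_finset_of_mem_extend {A C : Subring K} {I : Ideal C} {x : K}
    (hx : x ∈ extend I A) :
    ∃ s : Finset K, (∀ d ∈ s, d ∈ A) ∧ ∀ c : K, (∀ d ∈ s, c * d ∈ C) →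
      c * x ∈ (fun a : C => (a : K)) '' (I : Set C) := by
  classical
  obtain ⟨n, d, g, rfl⟩ := Submodule.mem_span_set'.mp hx
  choose i hi hig using fun k => (g k).2
  refine ⟨Finset.univ.image fun k => (d k : K), by simp, fun c hc => ?_⟩
  have hcd (k : Fin n) : c * d k ∈ C := hc _ (Finset.mem_image_of_mem _ (Finset.mem_univ k))
  refine ⟨∑ k, ⟨_, hcd k⟩ * i k, I.sum_mem fun k _ => I.mul_mem_left _ (hi k), ?_⟩
  simp [Finset.mul_sum, ← hig, Subring.smul_def, mul_assoc]

theorem bot_mem_sigma {A T : Subring K} (h : A ≤ T) : ⊥ ∈ sigma h :=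
  ⟨⊥, PrimeSpectrum.ext <|
    (RingHom.injective_iff_ker_eq_bot _).mp (Subring.inclusion_injective h)⟩

theorem mem_of_coe_eq_mul {A T : Subring K} {h : A ≤ T} {P : PrimeSpectrum A} (hP : P ∈ sigma h)
    {p c : A} (hp : p ∈ P.asIdeal) {t : K} (ht : t ∈ T) (hc : (c : K) = t * p) :
    c ∈ P.asIdeal := by
  obtain ⟨Q, rfl⟩ := hP
  have hcQ : Subring.inclusion h c = ⟨t, ht⟩ * Subring.inclusion h p := Subtype.ext hc
  exact Ideal.mem_comap.mpr (hcQ ▸ Q.asIdeal.mul_mem_left _ hp)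

theorem isJaffardFamily_singleton_self (A : Subring K) : IsJaffardFamily A {A} where
  overring := by rintro T rfl; exact le_rfl
  top_mem := (eq_or_ne ⊤ A).symm.imp id fun h => by rw [h]
  flat := by rintro T rfl; exact RingHom.Flat.id _
  complete I := by
    simp only [Set.mem_singleton_iff, Set.iInter_iInter_eq_left]
    refine Set.Subset.antisymm (fun x hx => Submodule.subset_span hx) fun x hx => ?_
    obtain ⟨s, hsA, hs⟩ := exists_finset_of_mem_extend (SetLike.mem_coe.mp hx)
    simpa using hs 1 (by simpa using hsA)
  independent := by rintro S rfl T rfl h; exact absurd rfl h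
  locallyFinite _ _ := (Set.finite_singleton A).subset fun _ h => h.1

/-- The ring `C` is the intersection of `A` and `B`, and every element of `K` is split into an
element of `A` and one of `B` by a partition of unity `1 = e + (1 - e)` in `C`. -/
structure IsSplitting (A B C : Subring K) : Prop where
  inf_eq : A ⊓ B = C
  exists_split : ∀ x : K, ∃ e ∈ C, e * x ∈ A ∧ (1 - e) * x ∈ B

namespace IsSplitting

variable {A B C : Subring K}

theorem symm (h : IsSplitting A B C) : IsSplitting B A C where
  inf_eq := inf_comm A B ▸ h.inf_eq
  exists_split x := by
    obtain ⟨e, he, hA, hB⟩ := h.exists_split x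
    exact ⟨1 - e, C.sub_mem C.one_mem he, hB, by simpa using hA⟩

theorem le_left (h : IsSplitting A B C) : C ≤ A := h.inf_eq ▸ inf_le_left

theorem le_right (h : IsSplitting A B C) : C ≤ B := h.inf_eq ▸ inf_le_right

theorem mem (h : IsSplitting A B C) {x : K} (hA : x ∈ A) (hB : x ∈ B) : x ∈ C :=
  h.inf_eq ▸ Subring.mem_inf.mpr ⟨hA, hB⟩

theorem eq_top_of_le (h : IsSplitting A B C) (hBA : B ≤ A) : A = ⊤ := by
  refine (Subring.eq_top_iff' A).mpr fun x => ?_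
  obtain ⟨e, -, hA, hB⟩ := h.exists_split x
  have hx : x = e * x + (1 - e) * x := by ring
  exact hx ▸ A.add_mem hA (hBA hB)

theorem sigma_inter_sigma (h : IsSplitting A B C) :
    sigma h.le_left ∩ sigma h.le_right = {⊥} := by
  refine Set.Subset.antisymm (fun P ⟨hPA, hPB⟩ => ?_)
    (Set.singleton_subset_iff.mpr ⟨bot_mem_sigma _, bot_mem_sigma _⟩)
  by_contra hP
  obtain ⟨p, hp, hp0⟩ := Submodule.exists_mem_ne_zero_of_ne_bot fun h => hP (PrimeSpectrum.ext h)
  have hp0 : (p : K) ≠ 0 := Subtype.coe_ne_coe.mpr hp0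
  obtain ⟨e, he, heA, heB⟩ := h.exists_split (p : K)⁻¹
  have heP : ⟨e, he⟩ ∈ P.asIdeal := mem_of_coe_eq_mul hPA hp heA (by field_simp)
  have heP' : 1 - ⟨e, he⟩ ∈ P.asIdeal := mem_of_coe_eq_mul hPB hp heB (by simp [hp0])
  exact P.2.one_notMem (by simpa using P.asIdeal.add_mem heP heP')

variable [IsFractionRing C K]

theorem exists_split_finset (h : IsSplitting A B C) (s : Finset K) :
    ∃ e ∈ C, ∀ x ∈ s, e * x ∈ A ∧ (1 - e) * x ∈ B := by
  obtain ⟨y, hy0, hyx⟩ := exists_common_denominator C s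
  obtain ⟨e, he, heA, heB⟩ := h.exists_split y⁻¹
  have hdiv (a x : K) : a * x = a * y⁻¹ * (y * x) := by field_simp
  refine ⟨e, he, fun x hx => ⟨?_, ?_⟩⟩
  · exact hdiv e x ▸ A.mul_mem heA (h.le_left (hyx x hx))
  · exact hdiv (1 - e) x ▸ B.mul_mem heB (h.le_right (hyx x hx))

theorem image_eq_inter_extend (h : IsSplitting A B C) (I : Ideal C) :
    (fun a : C => (a : K)) '' (I : Set C) = (extend I A : Set K) ∩ (extend I B : Set K) := by
  classical
  refine Set.Subset.antisymm (fun x hx => ⟨Submodule.subset_span hx, Submodule.subset_span hx⟩) ?_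
  rintro x ⟨hxA, hxB⟩
  obtain ⟨s, hsA, hs⟩ := exists_finset_of_mem_extend hxA
  obtain ⟨t, htB, ht⟩ := exists_finset_of_mem_extend hxB
  obtain ⟨e, he, hst⟩ := h.exists_split_finset (s ∪ t)
  obtain ⟨i, hi, hix⟩ := hs (1 - e) fun d hd =>
    h.mem (A.mul_mem (h.le_left (C.sub_mem C.one_mem he)) (hsA d hd))
      (hst d (Finset.mem_union_left t hd)).2
  obtain ⟨j, hj, hjx⟩ := ht e fun d hd =>
    h.mem (hst d (Finset.mem_union_right s hd)).1 (B.mul_mem (h.le_right he) (htB d hd))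
  refine ⟨i + j, I.add_mem hi hj, ?_⟩
  have hsum : ((i + j : C) : K) = (1 - e) * x + e * x := congrArg₂ (· + ·) hix hjx
  exact hsum.trans (by ring)

theorem flat_left (h : IsSplitting A B C) : (Subring.inclusion h.le_left).Flat := by
  classical
  let _ := (Subring.inclusion h.le_left).toAlgebra
  have coe_smul (c : C) (a : A) : ((c • a : A) : K) = c * a := rfl
  refine Module.Flat.of_forall_isTrivialRelation fun {l f x} hfx => ?_
  have hsum : ∑ i, (f i : K) * x i = 0 := by
    simpa [coe_smul] using congrArg A.subtype hfx
  obtain ⟨y, hy0, hyx⟩ :=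
    exists_common_denominator C (Finset.univ.image fun i => (x i : K))
  obtain ⟨e, he, heA, heB⟩ := h.exists_split y⁻¹
  have hyx (i : Fin l) : y * x i ∈ C := hyx _ (Finset.mem_image_of_mem _ (Finset.mem_univ i))
  have hex (i : Fin l) : (1 - e) * x i ∈ C := by
    refine h.mem (A.mul_mem (h.le_left (C.sub_mem C.one_mem he)) (x i).2) ?_
    have hdiv : (1 - e) * x i = (1 - e) * y⁻¹ * (y * x i) := by field_simp
    exact hdiv ▸ B.mul_mem heB (h.le_right (hyx i))
  have hsum_mul (c : K) : ∑ i, (f i : K) * (c * x i) = 0 := by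
    simp_rw [mul_left_comm _ c, ← Finset.mul_sum, hsum, mul_zero]
  -- The relation is trivialized by `x i = ((1 - e) * x i) • 1 + (y * x i) • (e / y)`.
  refine ⟨2, fun i => ![⟨_, hex i⟩, ⟨_, hyx i⟩], ![1, ⟨_, heA⟩], fun i => Subtype.ext ?_,
    fun j => Subtype.ext ?_⟩
  · simp only [Fin.sum_univ_two, Subring.coe_add, coe_smul, Matrix.cons_val_zero,
      Matrix.cons_val_one, Subring.coe_one]
    field_simp
    ring
  · fin_cases j
    · simpa using hsum_mul (1 - e)
    · simpa using hsum_mul y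

theorem isJaffardFamily (h : IsSplitting A B C) (hA : A ≠ ⊤) (hB : B ≠ ⊤) :
    IsJaffardFamily C {A, B} where
  overring := by rintro T (rfl | rfl); exacts [h.le_left, h.le_right]
  top_mem := Or.inl (by rintro (h | h); exacts [hA h.symm, hB h.symm])
  flat := by rintro T (rfl | rfl); exacts [h.flat_left, h.symm.flat_left]
  complete I := by simp [h.image_eq_inter_extend]
  independent := by
    rintro S (rfl | rfl) T (rfl | rfl) hST
    exacts [absurd rfl hST, h.sigma_inter_sigma, h.symm.sigma_inter_sigma, absurd rfl hST]
  locallyFinite _ _ := (Set.toFinite {A, B}).subset fun _ h => h.1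

theorem isJaffardOverring_left (h : IsSplitting A B C) (hA : A ≠ ⊤) : IsJaffardOverring C A := by
  by_cases hB : B = ⊤
  · obtain rfl : A = C := by simpa [hB] using h.inf_eq
    exact ⟨{A}, isJaffardFamily_singleton_self A, rfl⟩
  · exact ⟨{A, B}, h.isJaffardFamily hA hB, Set.mem_insert A _⟩

end IsSplitting

end Splitting

section ZeroDimensional

theorem isClopen_zeroLocus_of_fg {R : Type*} [CommRing R] [Ring.KrullDimLE 0 R] {I : Ideal R}
    (hI : I.FG) : IsClopen (PrimeSpectrum.zeroLocus (I : Set R)) := by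
  refine ⟨PrimeSpectrum.isClosed_zeroLocus _, ?_⟩
  rw [← isClosed_compl_iff]
  refine PrimeSpectrum.isClosed_of_stableUnderSpecialization_of_isConstructible
    (fun P Q hPQ hP => ?_) <|
    (PrimeSpectrum.isRetrocompact_zeroLocus_compl_of_fg hI).isConstructible
      (PrimeSpectrum.isClosed_zeroLocus _).isOpen_compl
  have hle : P.asIdeal ≤ Q.asIdeal := (PrimeSpectrum.le_iff_specializes P Q).mpr hPQ
  have hP' : P.asIdeal.IsMaximal := P.2.isMaximal'
  rwa [← PrimeSpectrum.ext (hP'.eq_of_le Q.2.ne_top hle)]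

theorem exists_dvd_mul_one_sub_and_mem_iff {R : Type*} [CommRing R] {y : R}
    [Ring.KrullDimLE 0 (R ⧸ Ideal.span {y})] {I : Ideal R} (hI : I.FG) :
    ∃ e : R, y ∣ e * (1 - e) ∧ ∀ P : Ideal R, P.IsPrime → y ∈ P → (e ∈ P ↔ I ≤ P) := by
  let π := Ideal.Quotient.mk (Ideal.span {y})
  have hπ : Function.Surjective π := Ideal.Quotient.mk_surjective
  obtain ⟨e', he', hloc⟩ :=
    PrimeSpectrum.isClopen_iff_zeroLocus.mp (isClopen_zeroLocus_of_fg (hI.map π))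
  obtain ⟨e, rfl⟩ := hπ e'
  refine ⟨e, ?_, fun P hP hy => ?_⟩
  · rw [← Ideal.mem_span_singleton, ← Ideal.Quotient.eq_zero_iff_mem, map_mul, map_sub, map_one]
    exact he'.mul_one_sub_self
  · have hker : RingHom.ker π ≤ P := by
      rwa [Ideal.mk_ker, Ideal.span_singleton_le_iff_mem]
    have hcomap : (P.map π).comap π = P := by
      rw [Ideal.comap_map_of_surjective' π hπ, sup_eq_left.mpr hker]
    have hmem := Set.ext_iff.mp hloc ⟨P.map π, Ideal.map_isPrime_of_surjective hπ hker⟩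
    rw [PrimeSpectrum.mem_zeroLocus, PrimeSpectrum.mem_zeroLocus, SetLike.coe_subset_coe,
      Ideal.map_le_iff_le_comap, Set.singleton_subset_iff, SetLike.mem_coe, ← Ideal.mem_comap,
      hcomap] at hmem
    exact hmem.symm

theorem krullDimLE_zero_quotient_span_singleton {D : Type*} [CommRing D] [IsDomain D]
    [Ring.KrullDimLE 1 D] {y : D} (hy : y ≠ 0) : Ring.KrullDimLE 0 (D ⧸ Ideal.span {y}) := by
  rw [Ring.krullDimLE_iff]
  have h1 : ringKrullDim D ≤ 1 := Ring.krullDimLE_iff.mp inferInstance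
  have h2 := ringKrullDim_quotient_succ_le_of_nonZeroDivisor (mem_nonZeroDivisors_of_ne_zero hy)
  exact ENat.WithBot.add_le_add_one_right_iff.mp (h2.trans h1)

end ZeroDimensional

section Topology

theorem isClosed_diff_singleton_of_notMem_derivedSet {X : Type*} [TopologicalSpace X] {s : Set X}
    (hs : IsClosed s) {x : X} (hx : x ∉ derivedSet s) : IsClosed (s \ {x}) := by
  refine isClosed_of_closure_subset fun y hy => ⟨hs.closure_subset_iff.mpr Set.sdiff_subset hy, ?_⟩
  rintro rfl
  exact hx (accPt_principal_iff_clusterPt.mpr (mem_closure_iff_clusterPt.mp hy))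

variable {D : Type u} [CommRing D]

/-- The maximal ideal of `D` that a point of `MaxInv D` stands for. -/
abbrev MaxInv.asIdeal (M : MaxInv D) : Ideal D := MaximalSpectrum.asIdeal M

instance (M : MaxInv D) : M.asIdeal.IsMaximal := MaximalSpectrum.isMaximal M

theorem isTopologicalBasis_inverseTopology :
    @TopologicalSpace.IsTopologicalBasis _ (inverseTopology D)
      {U | ∃ I : Ideal D, I.FG ∧ U = PrimeSpectrum.zeroLocus (I : Set D)} :=
  let _ := inverseTopology D
  { exists_subset_inter := by
      rintro _ ⟨I, hI, rfl⟩ _ ⟨J, hJ, rfl⟩ P hP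
      rw [← PrimeSpectrum.zeroLocus_sup] at hP ⊢
      exact ⟨_, ⟨I ⊔ J, Submodule.FG.sup hI hJ, rfl⟩, hP, le_rfl⟩
    sUnion_eq := Set.sUnion_eq_univ_iff.mpr fun _ =>
      ⟨_, ⟨⊥, Submodule.fg_bot, rfl⟩, by simp⟩
    eq_generateFrom := rfl }

theorem MaxInv.mem_nhds_iff {M : MaxInv D} {U : Set (MaxInv D)} :
    U ∈ nhds M ↔ ∃ I : Ideal D, I.FG ∧ I ≤ M.asIdeal ∧ ∀ N : MaxInv D, I ≤ N.asIdeal → N ∈ U := by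
  let _ := inverseTopology D
  have hbasis := (isTopologicalBasis_inverseTopology (D := D)).induced
    (MaximalSpectrum.toPrimeSpectrum (R := D))
  refine (hbasis.mem_nhds_iff (a := M)).trans ⟨?_, ?_⟩
  · rintro ⟨_, ⟨_, ⟨I, hI, rfl⟩, rfl⟩, hM, hU⟩
    exact ⟨I, hI, hM, fun N hN => hU hN⟩
  · rintro ⟨I, hI, hM, hU⟩
    exact ⟨_, ⟨_, ⟨I, hI, rfl⟩, rfl⟩, hM, fun N hN => hU N hN⟩

theorem MaxInv.exists_fg_of_notMem_isClosed {X : Set (MaxInv D)} (hX : IsClosed X) {M : MaxInv D}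
    (hM : M ∉ X) : ∃ I : Ideal D, I.FG ∧ I ≤ M.asIdeal ∧ ∀ N ∈ X, ¬ I ≤ N.asIdeal := by
  obtain ⟨I, hI, hIM, h⟩ := mem_nhds_iff.mp (hX.isOpen_compl.mem_nhds hM)
  exact ⟨I, hI, hIM, fun N hN hIN => h N hIN hN⟩

theorem MaxInv.notMem_derivedSet_of_fg {X : Set (MaxInv D)} {M : MaxInv D} {I : Ideal D}
    (hI : I.FG) (hIM : I ≤ M.asIdeal) (h : ∀ N ∈ X, I ≤ N.asIdeal → N = M) :
    M ∉ derivedSet X := by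
  rw [mem_derivedSet, accPt_iff_nhds]
  intro hacc
  obtain ⟨N, ⟨hIN, hN⟩, hne⟩ := hacc {N | I ≤ N.asIdeal} <|
    mem_nhds_iff.mpr ⟨I, hI, hIM, fun _ => id⟩
  exact hne (h N hN hIN)

end Topology

section Localization

variable {D : Type u} [CommRing D] {K : Type u} [Field K] [Algebra D K] [IsFractionRing D K]

theorem isFractionRing_of_range_le {C : Subring K} (hC : (algebraMap D K).range ≤ C) :
    IsFractionRing C K := by
  refine IsFractionRing.of_field C K fun x => ?_
  obtain ⟨a, b, -, hab⟩ := IsFractionRing.div_surjective D x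
  exact ⟨⟨_, hC ⟨a, rfl⟩⟩, ⟨_, hC ⟨b, rfl⟩⟩, hab.symm⟩

theorem algebraMap_ne_zero_of_notMem {I : Ideal D} {s : D} (hs : s ∉ I) :
    algebraMap D K s ≠ 0 :=
  (map_ne_zero_iff _ (IsFractionRing.injective D K)).mpr fun h => hs (h ▸ I.zero_mem)

variable [IsDomain D]

noncomputable instance (M : MaximalSpectrum D) : Algebra D (localizationAt D K M) :=
  inferInstanceAs (Algebra D (Localization.subalgebra.ofField K M.asIdeal.primeCompl
    M.asIdeal.primeCompl_le_nonZeroDivisors))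

instance (M : MaximalSpectrum D) : IsLocalization.AtPrime (localizationAt D K M) M.asIdeal :=
  Localization.subalgebra.isLocalization_ofField K M.asIdeal.primeCompl
    M.asIdeal.primeCompl_le_nonZeroDivisors

theorem range_algebraMap_le_localizationAt (M : MaximalSpectrum D) :
    (algebraMap D K).range ≤ localizationAt D K M := by
  rintro _ ⟨a, rfl⟩
  exact (algebraMap D (localizationAt D K M) a).2

theorem mem_localizationAt {M : MaximalSpectrum D} {x : K} :
    x ∈ localizationAt D K M ↔
      ∃ s ∉ M.asIdeal, ∃ a, algebraMap D K s * x = algebraMap D K a := by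
  constructor
  · rintro ⟨a, s, hs, rfl⟩
    have hs0 : algebraMap D K s ≠ 0 := algebraMap_ne_zero_of_notMem hs
    exact ⟨s, hs, a, by field_simp⟩
  · rintro ⟨s, hs, a, h⟩
    have hs0 : algebraMap D K s ≠ 0 := algebraMap_ne_zero_of_notMem hs
    exact ⟨a, s, hs, by rw [← h]; field_simp⟩

theorem inv_mem_localizationAt_iff {M : MaximalSpectrum D} {a : D} (ha : a ≠ 0) :
    (algebraMap D K a)⁻¹ ∈ localizationAt D K M ↔ a ∉ M.asIdeal := by
  have ha' : algebraMap D K a ≠ 0 := (map_ne_zero_iff _ (IsFractionRing.injective D K)).mpr ha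
  refine ⟨fun h haM => ?_, fun h => mem_localizationAt.mpr ⟨a, h, 1, by simp [ha']⟩⟩
  obtain ⟨s, hs, b, hb⟩ := mem_localizationAt.mp h
  rw [← div_eq_mul_inv, div_eq_iff ha', ← map_mul] at hb
  exact hs (IsFractionRing.injective D K hb ▸ M.asIdeal.mul_mem_left b haM)

theorem div_mem_localizationAt {M : MaximalSpectrum D} {s e y : D} (hy : y ≠ 0)
    (hs : y ∈ M.asIdeal → s ∉ M.asIdeal) (hse : y ∣ s * e) :
    algebraMap D K e / algebraMap D K y ∈ localizationAt D K M := by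
  have hy' : algebraMap D K y ≠ 0 := (map_ne_zero_iff _ (IsFractionRing.injective D K)).mpr hy
  by_cases hyM : y ∈ M.asIdeal
  · obtain ⟨c, hc⟩ := hse
    refine mem_localizationAt.mpr ⟨s, hs hyM, c, ?_⟩
    rw [← mul_div_assoc, div_eq_iff hy', ← map_mul, ← map_mul, hc, mul_comm]
  · exact mem_localizationAt.mpr ⟨y, hyM, e, mul_div_cancel₀ _ hy'⟩

theorem localizationAt_injective : Function.Injective (localizationAt D K) := by
  intro M N hMN
  refine MaximalSpectrum.ext (M.2.eq_of_le N.2.ne_top fun a haM => ?_)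
  by_contra haN
  have ha : a ≠ 0 := fun h => haN (h ▸ N.asIdeal.zero_mem)
  have hinv : (algebraMap D K a)⁻¹ ∈ localizationAt D K M :=
    hMN ▸ (inv_mem_localizationAt_iff ha).mpr haN
  exact (inv_mem_localizationAt_iff ha).mp hinv haM

theorem localizationAt_ne_top {M : MaximalSpectrum D} (hM : M.asIdeal ≠ ⊥) :
    localizationAt D K M ≠ ⊤ := by
  obtain ⟨a, haM, ha⟩ := Submodule.exists_mem_ne_zero_of_ne_bot hM
  exact fun h => (inv_mem_localizationAt_iff ha).mp (h ▸ Subring.mem_top _) haM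

variable (D K) in
/-- The intersection of the localizations of `D` at the maximal ideals in `X`, which is `K` when
`X` is empty. -/
noncomputable def interLocalizations (X : Set (MaxInv D)) : Subring K :=
  ⨅ M ∈ X, localizationAt D K M

theorem interLocalizations_le {X : Set (MaxInv D)} {M : MaxInv D} (hM : M ∈ X) :
    interLocalizations D K X ≤ localizationAt D K M :=
  iInf₂_le M hM

theorem mem_interLocalizations {X : Set (MaxInv D)} {x : K} :
    x ∈ interLocalizations D K X ↔ ∀ N ∈ X, x ∈ localizationAt D K N := by
  simp only [interLocalizations, Subring.mem_iInf]

theorem interLocalizations_univ :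
    interLocalizations D K Set.univ = (algebraMap D K).range := by
  ext x
  rw [mem_interLocalizations, RingHom.mem_range, ← Set.mem_range, ← Algebra.mem_bot,
    ← MaximalSpectrum.iInf_localization_eq_bot D K, Algebra.mem_iInf]
  exact ⟨fun h v => h v trivial, fun h v _ => h v⟩

theorem interLocalizations_insert (X : Set (MaxInv D)) (M : MaxInv D) :
    interLocalizations D K (insert M X) = localizationAt D K M ⊓ interLocalizations D K X :=
  iInf_insert

theorem range_algebraMap_le_interLocalizations (X : Set (MaxInv D)) :
    (algebraMap D K).range ≤ interLocalizations D K X :=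
  le_iInf₂ fun M _ => range_algebraMap_le_localizationAt M

instance (X : Set (MaxInv D)) : IsFractionRing (interLocalizations D K X) K :=
  isFractionRing_of_range_le (range_algebraMap_le_interLocalizations X)

variable (D K) in
/-- The family of the localizations of `D` at the maximal ideals in `X`. -/
def localizationsOn (X : Set (MaxInv D)) : Set (Subring K) :=
  (fun M : MaxInv D => localizationAt D K M) '' X

theorem localizationsOn_univ : localizationsOn D K Set.univ = maxLocalizations D K :=
  Set.image_univ

theorem localizationsOn_iInter {ι : Type*} [Nonempty ι] (X : ι → Set (MaxInv D)) :
    localizationsOn D K (⋂ i, X i) = ⋂ i, localizationsOn D K (X i) :=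
  (localizationAt_injective (D := D) (K := K)).injOn.image_iInter_eq

theorem sInf_localizationsOn (X : Set (MaxInv D)) :
    sInf (localizationsOn D K X) = interLocalizations D K X :=
  sInf_image

end Localization

section DimensionOne

variable {D : Type u} [CommRing D] [IsDomain D] [Ring.KrullDimLE 1 D] {K : Type u} [Field K]
  [Algebra D K] [IsFractionRing D K] {X : Set (MaxInv D)} {M : MaxInv D}

theorem isSplitting_localizationAt (hX : IsClosed X) (hM : M ∉ X) :
    IsSplitting (localizationAt D K M) (interLocalizations D K X)
      (interLocalizations D K (insert M X)) where
  inf_eq := (interLocalizations_insert X M).symm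
  exists_split x := by
    obtain ⟨I, hI, hIM, hIX⟩ := MaxInv.exists_fg_of_notMem_isClosed hX hM
    obtain ⟨a, y, hy, rfl⟩ := IsFractionRing.div_surjective D x
    have hy : y ≠ 0 := nonZeroDivisors.ne_zero hy
    have := krullDimLE_zero_quotient_span_singleton hy
    obtain ⟨e, hye, he⟩ := exists_dvd_mul_one_sub_and_mem_iff (y := y) hI
    have heM : algebraMap D K e / algebraMap D K y ∈ localizationAt D K M := by
      refine div_mem_localizationAt hy (fun hyM h => ?_) (mul_comm e _ ▸ hye)
      have he' : e ∈ M.asIdeal := (he _ inferInstance hyM).mpr hIM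
      exact M.2.isPrime.one_notMem (by simpa using M.asIdeal.add_mem h he')
    have heX : algebraMap D K (1 - e) / algebraMap D K y ∈ interLocalizations D K X :=
      mem_interLocalizations.mpr fun N hN => div_mem_localizationAt hy
        (fun hyN h => hIX N hN ((he N.asIdeal inferInstance hyN).mp h)) hye
    refine ⟨algebraMap D K e, range_algebraMap_le_interLocalizations _ ⟨e, rfl⟩, ?_, ?_⟩
    · rw [mul_div_left_comm]
      exact mul_mem (range_algebraMap_le_localizationAt M ⟨a, rfl⟩) heM
    · rw [← map_one (algebraMap D K), ← map_sub, mul_div_left_comm]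
      exact mul_mem (range_algebraMap_le_interLocalizations X ⟨a, rfl⟩) heX

theorem interLocalizations_le_localizationAt_iff (hM : M.asIdeal ≠ ⊥) (hX : IsClosed X) :
    interLocalizations D K X ≤ localizationAt D K M ↔ M ∈ X := by
  refine ⟨fun hle => ?_, interLocalizations_le⟩
  by_contra hMX
  exact localizationAt_ne_top hM ((isSplitting_localizationAt hX hMX).eq_top_of_le hle)

theorem isJaffardOverring_of_notMem_derivedSet (hX : IsClosed X) (hMX : M ∈ X)
    (hM : M.asIdeal ≠ ⊥) (hd : M ∉ derivedSet X) :
    IsJaffardOverring (interLocalizations D K X) (localizationAt D K M) := by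
  have hsplit := isSplitting_localizationAt (K := K)
    (isClosed_diff_singleton_of_notMem_derivedSet hX hd) fun h => h.2 rfl
  rw [Set.insert_sdiff_singleton, Set.insert_eq_of_mem hMX] at hsplit
  exact hsplit.isJaffardOverring_left (localizationAt_ne_top hM)

end DimensionOne

section JaffardFamily

theorem exists_fg_le_map_eq_top {R S : Type*} [CommRing R] [CommRing S] {f : R →+* S}
    {I : Ideal R} (h : I.map f = ⊤) : ∃ J ≤ I, J.FG ∧ J.map f = ⊤ := by
  classical
  have hone : (1 : S) ∈ Submodule.span S (f '' I) := (Ideal.eq_top_iff_one _).mp h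
  obtain ⟨t, htI, ht⟩ := Submodule.mem_span_finite_of_mem_span hone
  obtain ⟨u, huI, rfl⟩ := Finset.subset_set_image_iff.mp htI
  refine ⟨Ideal.span u, Ideal.span_le.mpr huI, ⟨u, rfl⟩, ?_⟩
  rw [Ideal.map_span, Ideal.eq_top_iff_one]
  simpa using ht

theorem exists_fg_le_forall_map_eq_top {R ι : Type*} [CommRing R] {I : Ideal R} {s : Set ι}
    (hs : s.Finite) {S : ι → Type*} [∀ i, CommRing (S i)] (f : ∀ i, R →+* S i)
    (h : ∀ i ∈ s, I.map (f i) = ⊤) : ∃ J ≤ I, J.FG ∧ ∀ i ∈ s, J.map (f i) = ⊤ := by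
  choose! J hJI hJ hJtop using fun i hi => exists_fg_le_map_eq_top (h i hi)
  refine ⟨hs.toFinset.sup J, Finset.sup_le fun i hi => hJI i (hs.mem_toFinset.mp hi),
    Submodule.fg_finset_sup _ _ fun i hi => hJ i (hs.mem_toFinset.mp hi), fun i hi => ?_⟩
  rw [← top_le_iff, ← hJtop i hi]
  exact Ideal.map_mono (Finset.le_sup (hs.mem_toFinset.mpr hi))

variable {K : Type u} [Field K]

theorem coe_mem_extend_iff {A T : Subring K} (h : A ≤ T) {I : Ideal A} {t : T} :
    (t : K) ∈ extend I T ↔ t ∈ I.map (Subring.inclusion h) := by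
  have hmap : extend I T =
      Submodule.map (Algebra.linearMap T K) (I.map (Subring.inclusion h)) := by
    rw [Ideal.map, Ideal.span, Submodule.map_span, ← Set.image_comp]
    rfl
  rw [hmap]
  exact T.subtype_injective.mem_set_image

namespace IsJaffardFamily

variable {A : Subring K} {Λ : Set (Subring K)}

theorem exists_map_ne_top (hΛ : IsJaffardFamily A Λ) {I : Ideal A} (hI : I ≠ ⊤) :
    ∃ S, ∃ hS : S ∈ Λ, I.map (Subring.inclusion (hΛ.overring S hS)) ≠ ⊤ := by
  by_contra! h
  have hone : (1 : K) ∈ ⋂ T ∈ Λ, (extend I T : Set K) := Set.mem_iInter₂.mpr fun T hT =>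
    (coe_mem_extend_iff (hΛ.overring T hT) (t := 1)).mpr (h T hT ▸ Submodule.mem_top)
  obtain ⟨a, ha, ha1⟩ := hΛ.complete I ▸ hone
  obtain rfl : a = 1 := Subtype.ext ha1
  exact hI ((Ideal.eq_top_iff_one I).mpr ha)

theorem map_eq_top (hΛ : IsJaffardFamily A Λ) {S T : Subring K} (hS : S ∈ Λ) (hT : T ∈ Λ)
    (hST : S ≠ T) {I : Ideal A} (hI : I ≠ ⊥)
    (hIT : PrimeSpectrum.zeroLocus I ⊆ sigma (hΛ.overring T hT)) :
    I.map (Subring.inclusion (hΛ.overring S hS)) = ⊤ := by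
  by_contra h
  obtain ⟨Q, hQ, hIQ⟩ := Ideal.exists_le_maximal _ h
  let P := PrimeSpectrum.comap (Subring.inclusion (hΛ.overring S hS)) ⟨Q, hQ.isPrime⟩
  have hIP : I ≤ P.asIdeal := Ideal.map_le_iff_le_comap.mp hIQ
  have hP : P ∈ ({⊥} : Set (PrimeSpectrum A)) :=
    hΛ.independent S hS T hT hST ▸ ⟨⟨_, rfl⟩, hIT hIP⟩
  exact hI (le_bot_iff.mp (hIP.trans (congrArg PrimeSpectrum.asIdeal hP).le))

theorem exists_fg_map_eq_top {R : Type*} [CommRing R] (hΛ : IsJaffardFamily A Λ) {T : Subring K}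
    (hT : T ∈ Λ) (f : R →+* A) {I : Ideal R} (hI : I.map f ≠ ⊥)
    (hIT : PrimeSpectrum.zeroLocus (I.map f) ⊆ sigma (hΛ.overring T hT)) :
    ∃ J ≤ I, J.FG ∧ ∀ S (hS : S ∈ Λ), S ≠ T →
      (J.map f).map (Subring.inclusion (hΛ.overring S hS)) = ⊤ := by
  obtain ⟨x, hxI, hx⟩ : ∃ x ∈ I, f x ≠ 0 := by
    by_contra! h
    exact hI (Ideal.map_eq_bot_iff_le_ker f |>.mpr h)
  let g (S : Λ) : R →+* S := (Subring.inclusion (hΛ.overring S S.2)).comp f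
  have hfin : {S : Λ | (S : Subring K) ≠ T ∧ ¬ IsUnit (g S x)}.Finite :=
    ((hΛ.locallyFinite (f x) fun h => hx (Subtype.ext h)).preimage
      Subtype.val_injective.injOn).subset fun S hS => ⟨S.2, (g S x).2, hS.2⟩
  obtain ⟨J, hJI, hJ, hJtop⟩ := exists_fg_le_forall_map_eq_top hfin g fun S hS => by
    rw [← Ideal.map_map]
    exact hΛ.map_eq_top S.2 hT hS.1 hI hIT
  refine ⟨J ⊔ Ideal.span {x}, sup_le hJI ((Ideal.span_singleton_le_iff_mem I).mpr hxI),
    Submodule.FG.sup hJ (Submodule.fg_span_singleton x), fun S hS hST => top_le_iff.mp ?_⟩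
  rw [Ideal.map_map, Ideal.map_sup]
  by_cases hu : IsUnit (g ⟨S, hS⟩ x)
  · refine le_trans (Eq.ge ?_) le_sup_right
    rw [Ideal.map_span, Set.image_singleton, Ideal.span_singleton_eq_top]
    exact hu
  · exact (hJtop ⟨S, hS⟩ ⟨hST, hu⟩).ge.trans le_sup_left

end IsJaffardFamily

end JaffardFamily

section Isolated

variable {D : Type u} [CommRing D] [IsDomain D] {K : Type u} [Field K] [Algebra D K]
  [IsFractionRing D K] {X : Set (MaxInv D)} {M : MaximalSpectrum D}

variable (K) in
/-- The inclusion of `D` in the intersection of its localizations at the maximal ideals in `X`,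
through which ideals of `D` are extended to that ring. -/
noncomputable def toInterLocalizations (X : Set (MaxInv D)) : D →+* interLocalizations D K X :=
  (algebraMap D K).codRestrict _ fun a => range_algebraMap_le_interLocalizations X ⟨a, rfl⟩

theorem inclusion_comp_toInterLocalizations (hMX : M ∈ X) :
    (Subring.inclusion (interLocalizations_le hMX)).comp (toInterLocalizations K X) =
      algebraMap D (localizationAt D K M) :=
  rfl

theorem map_toInterLocalizations_ne_top (hMX : M ∈ X) :
    M.asIdeal.map (toInterLocalizations K X) ≠ ⊤ := by
  intro h
  have := IsLocalization.AtPrime.isLocalRing (localizationAt D K M) M.asIdeal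
  refine (IsLocalRing.maximalIdeal.isMaximal (localizationAt D K M)).ne_top ?_
  rw [← IsLocalization.AtPrime.map_eq_maximalIdeal M.asIdeal,
    ← inclusion_comp_toInterLocalizations hMX, ← Ideal.map_map, h, Ideal.map_top]

theorem le_of_comap_toInterLocalizations_eq (hMX : M ∈ X)
    {P Q : Ideal (interLocalizations D K X)} [P.IsPrime] [Q.IsPrime]
    (hP : P.comap (toInterLocalizations K X) = M.asIdeal)
    (hQ : Q.comap (toInterLocalizations K X) = M.asIdeal) : P ≤ Q := by
  intro x hx
  obtain ⟨s, hs, a, ha⟩ := mem_localizationAt.mp (interLocalizations_le hMX x.2)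
  have hsx : toInterLocalizations K X s * x = toInterLocalizations K X a := Subtype.ext ha
  have haM : a ∈ M.asIdeal := hP ▸ Ideal.mem_comap.mpr (hsx ▸ P.mul_mem_left _ hx)
  have hsxQ : toInterLocalizations K X s * x ∈ Q := hsx ▸ Ideal.mem_comap.mp (hQ ▸ haM)
  exact (Ideal.IsPrime.mem_or_mem ‹_› hsxQ).resolve_left fun h =>
    hs (hQ ▸ Ideal.mem_comap.mpr h : s ∈ M.asIdeal)

theorem zeroLocus_map_subset_sigma (hMX : M ∈ X) :
    PrimeSpectrum.zeroLocus (M.asIdeal.map (toInterLocalizations K X)) ⊆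
      sigma (interLocalizations_le (K := K) hMX) := by
  intro P hP
  have := IsLocalization.AtPrime.isLocalRing (localizationAt D K M) M.asIdeal
  have hPM : P.asIdeal.comap (toInterLocalizations K X) = M.asIdeal :=
    M.isMaximal.eq_of_le (P.2.comap _).ne_top
      (Ideal.map_le_iff_le_comap.mp hP) |>.symm
  let Q := PrimeSpectrum.comap (Subring.inclusion (interLocalizations_le hMX))
    (IsLocalRing.closedPoint (localizationAt D K M))
  have hQM : Q.asIdeal.comap (toInterLocalizations K X) = M.asIdeal :=
    IsLocalization.AtPrime.under_maximalIdeal (localizationAt D K M) M.asIdeal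
  exact ⟨_, PrimeSpectrum.ext <| (le_of_comap_toInterLocalizations_eq hMX hQM hPM).antisymm
    (le_of_comap_toInterLocalizations_eq hMX hPM hQM)⟩

theorem notMem_derivedSet_of_isJaffardOverring (hMX : M ∈ X) (hM : M.asIdeal ≠ ⊥)
    (h : IsJaffardOverring (interLocalizations D K X) (localizationAt D K M)) :
    M ∉ derivedSet X := by
  obtain ⟨Λ, hΛ, hMΛ⟩ := h
  have hM' : M.asIdeal.map (toInterLocalizations K X) ≠ ⊥ := by
    rwa [Ne, Ideal.map_eq_bot_iff_of_injective]
    exact fun a b hab => IsFractionRing.injective D K (congrArg Subtype.val hab)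
  obtain ⟨J, hJM, hJ, hJtop⟩ := hΛ.exists_fg_map_eq_top hMΛ (toInterLocalizations K X) hM'
    (zeroLocus_map_subset_sigma hMX)
  refine MaxInv.notMem_derivedSet_of_fg hJ hJM fun N hNX hJN => ?_
  obtain ⟨S, hS, hNS⟩ := hΛ.exists_map_ne_top (map_toInterLocalizations_ne_top hNX)
  obtain rfl : S = localizationAt D K M := by
    by_contra hSM
    exact hNS (top_le_iff.mp <| hJtop S hS hSM ▸ Ideal.map_mono (Ideal.map_mono hJN))
  rw [Ideal.map_map, inclusion_comp_toInterLocalizations hMX] at hNS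
  have hNM : N.asIdeal ≤ M.asIdeal :=
    not_imp_comm.mp (IsLocalization.AtPrime.map_eq_top_of_not_le _) hNS
  exact MaximalSpectrum.ext ((MaximalSpectrum.isMaximal N).eq_of_le
    M.isMaximal.ne_top hNM)

end Isolated

section DerivedSequence

open CantorBendixson

theorem iteratedDerivedSet_eq_add_one_iff {X : Type u} [TopologicalSpace X] {s : Set X}
    {α : Ordinal.{u}} : iteratedDerivedSet s α = iteratedDerivedSet s (α + 1) ↔
      ∀ β > α, iteratedDerivedSet s α = iteratedDerivedSet s β := by
  refine ⟨fun h β hβ => ?_, fun h => h _ (lt_add_one α)⟩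
  exact (OrdinalApprox.gfpApprox_eq_of_mem_fixedPoints relDerivedSet hβ.le
    (mem_fixedPoints_of_iteratedDerivedSet_succ_eq h.symm)).symm

variable {D : Type u} [CommRing D] [IsDomain D] {K : Type u} [Field K] [Algebra D K]
  [IsFractionRing D K]

theorem derivedRing_eq_interLocalizations_of_derivedFamily_eq {α : Ordinal.{u}}
    (h : derivedFamily (algebraMap D K).range (maxLocalizations D K) α =
      localizationsOn D K (iteratedDerivedSet Set.univ α)) :
    derivedRing (algebraMap D K).range (maxLocalizations D K) α =
      interLocalizations D K (iteratedDerivedSet Set.univ α) := by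
  by_cases hα : α = 0
  · rw [hα, derivedRing_zero, iteratedDerivedSet_zero, interLocalizations_univ]
  · rw [derivedRing_eq_sInf _ _ hα, h, sInf_localizationsOn]

variable [Ring.KrullDimLE 1 D]

theorem isJaffardOverring_localizationAt_iff {X : Set (MaxInv D)} (hX : IsClosed X)
    {M : MaximalSpectrum D} (hMX : M ∈ X) (hM : M.asIdeal ≠ ⊥) :
    IsJaffardOverring (interLocalizations D K X) (localizationAt D K M) ↔ M ∉ derivedSet X :=
  ⟨notMem_derivedSet_of_isJaffardOverring hMX hM, isJaffardOverring_of_notMem_derivedSet hX hMX hM⟩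

theorem localizationsOn_diff_isJaffardOverring (hmax : ∀ M : MaximalSpectrum D, M.asIdeal ≠ ⊥)
    {X : Set (MaxInv D)} (hX : IsClosed X) :
    localizationsOn D K X \ {T | IsJaffardOverring (interLocalizations D K X) T} =
      localizationsOn D K (relDerivedSet X) := by
  rw [relDerivedSet_apply]
  ext T
  constructor
  · rintro ⟨⟨M, hM, rfl⟩, hT⟩
    exact ⟨M, ⟨of_not_not (mt (isJaffardOverring_localizationAt_iff hX hM (hmax M)).mpr hT), hM⟩,
      rfl⟩
  · rintro ⟨M, ⟨hMX, hM⟩, rfl⟩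
    exact ⟨⟨M, hM, rfl⟩, fun hT =>
      (isJaffardOverring_localizationAt_iff hX hM (hmax M)).mp hT hMX⟩

theorem derivedFamily_maxLocalizations (hmax : ∀ M : MaximalSpectrum D, M.asIdeal ≠ ⊥)
    (α : Ordinal.{u}) :
    derivedFamily (algebraMap D K).range (maxLocalizations D K) α =
      localizationsOn D K (iteratedDerivedSet Set.univ α) := by
  induction α using Ordinal.limitRecOn with
  | zero =>
    rw [derivedFamily_zero, iteratedDerivedSet_zero, localizationsOn_univ]
  | add_one α ih =>
    rw [derivedFamily_add_one, derivedRing_eq_interLocalizations_of_derivedFamily_eq ih, ih,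
      iteratedDerivedSet_succ]
    exact localizationsOn_diff_isJaffardOverring hmax
      (isClosed_iteratedDerivedSet isClosed_univ α)
  | limit α hα ih =>
    have : Nonempty (Set.Iio α) := ⟨0, hα.bot_lt⟩
    rw [derivedFamily_limit _ _ hα, iteratedDerivedSet_limit hα, localizationsOn_iInter,
      Set.iInter₂_congr ih]
    exact Set.biInter_eq_iInter (Set.Iio α) _

theorem derivedRing_maxLocalizations_eq_iff (hmax : ∀ M : MaximalSpectrum D, M.asIdeal ≠ ⊥)
    {α β : Ordinal.{u}} :
    derivedRing (algebraMap D K).range (maxLocalizations D K) α =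
        derivedRing (algebraMap D K).range (maxLocalizations D K) β ↔
      iteratedDerivedSet (Set.univ : Set (MaxInv D)) α = iteratedDerivedSet Set.univ β := by
  rw [derivedRing_eq_interLocalizations_of_derivedFamily_eq (derivedFamily_maxLocalizations hmax α),
    derivedRing_eq_interLocalizations_of_derivedFamily_eq (derivedFamily_maxLocalizations hmax β)]
  refine ⟨fun h => Set.ext fun M => ?_, fun h => h ▸ rfl⟩
  rw [← interLocalizations_le_localizationAt_iff (K := K) (hmax M)
      (isClosed_iteratedDerivedSet isClosed_univ α), h,
    interLocalizations_le_localizationAt_iff (hmax M)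
      (isClosed_iteratedDerivedSet isClosed_univ β)]

end DerivedSequence

end JaffardDegree

theorem mainTheorem4 (D : Type u) [CommRing D] [IsDomain D] (K : Type u) [Field K] [Algebra D K]
    [IsFractionRing D K] (hdim : ringKrullDim D = 1) :
    JaffardDegree.jaffardDegree (algebraMap D K).range (JaffardDegree.maxLocalizations D K) =
      JaffardDegree.cantorBendixsonRank (JaffardDegree.MaxInv D) := by
  have hle : Ring.KrullDimLE 1 D := Ring.krullDimLE_iff.mpr hdim.le
  have hmax : ∀ M : MaximalSpectrum D, M.asIdeal ≠ ⊥ := fun M => by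
    refine Ring.ne_bot_of_isMaximal_of_not_isField M.2 fun hD => ?_
    rw [ringKrullDim_eq_zero_of_isField hD] at hdim
    exact zero_ne_one hdim
  unfold JaffardDegree.jaffardDegree JaffardDegree.cantorBendixsonRank
  simp_rw [JaffardDegree.derivedRing_maxLocalizations_eq_iff hmax,
    JaffardDegree.iteratedDerivedSet_eq_add_one_iff]
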